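/- **Theorem 3.1 (Basis rescaling).** Let $\mathcal H=\bigoplus_{n\ge 0}\mathcal H_n$ be a graded connected Hopf algebra over $\mathbb R$ (so $\mathcal H_0=\mathbb R$, each $\mathcal H_n$ is finite-dimensional, and product, coproduct $\Delta$ and counit respect the grading) which, as an algebra, is either a polynomial algebra, or a free associative algebra with $\mathcal H$ cocommutative, on a set of homogeneous generators. Let $\mathcal B$ be the basis of monomials (words) in the generators and $\mathcal B_n=\mathcal B\cap\mathcal H_n$. Suppose that for every generator $c$ with $\deg(c)>1$ all coefficients of $\Delta(c)$ in the basis $\mathcal B\otimes\mathcal B$ are non-negative, and $\bar\Delta(c):=\Delta(c)-1\otimes c-c\otimes 1\neq 0$. Let $\Psi^a=m^{[a]}\Delta^{[a]}$ be the $a$-th Hopf power map ($a$-fold coproduct followed by $a$-fold product), and define $K_a$ on $\mathcal B_n$ by $a^{-n}\Psi^a(b)=\sum_{b'\in\mathcal B_n}K_a(b,b')\,b'$ for $b\in\mathcal B_n$. Define, by induction on degree, $$\hat c=c\quad\text{if }\deg(c)=1,\qquad \hat c=\frac{1-2^{1-\deg(c)}}{\sum_{b\in\mathcal B_{\deg(c)},\,b\neq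 c}\phi(b)\,K_2(c,b)}\;c\quad\text{for a generator $c$ with }\deg(c)>1,$$ $$\hat b=\hat c_1\cdots\hat c_l\quad\text{for $b\in\mathcal B$ with factorization $b=c_1\cdots c_l$ into generators},$$ where $\phi(b)$ is the scalar with $b=\phi(b)\hat b$. Then: 1. This definition is well posed: there is exactly one pair $(b\mapsto\hat b,\ \phi)$ satisfying these rules, all the denominators are positive, and $\phi(b)>0$ for every $b\in\mathcal B$. 2. $\hat{\mathcal B}=\{\hat b: b\in\mathcal B\}$ is a basis of $\mathcal H$, and for each $n\ge 0$, $\hat{\mathcal B}_n=\{\hat b: b\in\mathcal B_n\}$ is a basis of $\mathcal H_n$. 3. For all $n\ge0$ and all integers $a\ge1$ (and also for $a=n=0$, with $0^0=1$), the matrix $\hat K_a$ on $\hat{\mathcal B}_n$ defined by $a^{-n}\Psi^a(\hat b)=\sum_{b'\in\mathcal B_n}\hat K_a(\hat b,\hat b')\,\hat b'$, that is, the transpose of the matrix of $a^{-n}\Psi^a$ with respect to $\hat{\mathcal B}_n$, is given by $\hat K_a(\hat b,\hat b')=\phi(b)^{-1}K_a(b,b')\phi(b')$ and is a transition matrix: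 $\hat K_a(\hat b,\hat b')\ge 0$ for all $b,b'\in\mathcal B_n$, and $\sum_{b'\in\mathcal B_n}\hat K_a(\hat b,\hat b')=1$ for all $b\in\mathcal B_n$. The same rescaling works simultaneously for all $a$ (and all $n$). -/

import Mathlib

open scoped TensorProduct

noncomputable section

namespace HopfPower

section Power

variable {H : Type*} [Ring H] [HopfAlgebra ℝ H]

/-- The identification `H ≃ H^{⊗ 1}`. -/
def toTensorOne : H ≃ₗ[ℝ] ⨂[ℝ]^1 H :=
  (PiTensorProduct.subsingletonEquiv (R := ℝ) (s := fun _ : Fin 1 => H) 0).symm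

/-- The `a`-fold coproduct `Δ^[a] : H → H^{⊗ a}`, with `Δ^[0]` the counit (followed by `ℝ ≃ H^{⊗ 0}`)
and `Δ^[a+1] = (Δ^[a] ⊗ ι) ∘ Δ`.  So `Δ^[1] = ι` and `Δ^[2] = Δ`; by coassociativity it does not
matter which tensor factor is expanded at each stage. -/
def iterComul : (a : ℕ) → H →ₗ[ℝ] ⨂[ℝ]^a H
  | 0 => (TensorPower.algebraMap₀ (R := ℝ) (M := H)).toLinearMap ∘ₗ Coalgebra.counit
  | a + 1 =>
      (TensorPower.mulEquiv (R := ℝ) (M := H) (n := a) (m := 1)).toLinearMap ∘ₗ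
        TensorProduct.map (iterComul a)
          (toTensorOne (H := H)).toLinearMap ∘ₗ
        Coalgebra.comul

/-- The `a`-fold product `m^[a] : H^{⊗ a} → H`, `x₁ ⊗ ⋯ ⊗ xₐ ↦ x₁ ⋯ xₐ`. -/
def iterMul (a : ℕ) : ⨂[ℝ]^a H →ₗ[ℝ] H :=
  PiTensorProduct.lift (MultilinearMap.mkPiAlgebraFin ℝ a H)

/-- The `a`-th Hopf power map `Ψ^a = m^[a] ∘ Δ^[a]`. -/
def powerMap (a : ℕ) : H →ₗ[ℝ] H := iterMul a ∘ₗ iterComul a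

theorem iterMul_mulEquiv (a : ℕ) (t : ⨂[ℝ]^a H) (y : H) :
    iterMul (a + 1) (TensorPower.mulEquiv (R := ℝ) (M := H) (n := a) (m := 1)
      (t ⊗ₜ[ℝ] toTensorOne y)) =
      iterMul a t * y := by
  induction t using PiTensorProduct.induction_on with
  | smul_tprod r f =>
    have h1 : toTensorOne y =
        PiTensorProduct.tprod ℝ (fun _ => y) := by
      simp [toTensorOne]
    have h2 : TensorPower.mulEquiv (R := ℝ) (M := H) (n := a) (m := 1)
        (PiTensorProduct.tprod ℝ f ⊗ₜ[ℝ] PiTensorProduct.tprod ℝ (fun _ => y)) =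
        PiTensorProduct.tprod ℝ (Fin.append f (fun _ => y)) :=
      TensorPower.tprod_mul_tprod ℝ f (fun _ => y)
    rw [h1, ← TensorProduct.smul_tmul', map_smul, map_smul, h2, map_smul, smul_mul_assoc]
    congr 1
    simp [iterMul, List.ofFn_fin_append, -List.ofFn_succ]
  | add x z hx hz => rw [TensorProduct.add_tmul, map_add, map_add, hx, hz, map_add, add_mul]

/-- `Ψ^0` is the unit composed with the counit. -/
theorem powerMap_zero :
    powerMap (H := H) 0 = Algebra.linearMap ℝ H ∘ₗ Coalgebra.counit := by
  ext x
  have : (TensorPower.algebraMap₀ (R := ℝ) (M := H) (Coalgebra.counit (R := ℝ) x)) =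
      (Coalgebra.counit (R := ℝ) x) • PiTensorProduct.tprod ℝ (@Fin.elim0 H) := by
    rw [TensorPower.algebraMap₀_eq_smul_one]; rfl
  simp [powerMap, iterMul, iterComul, this, Algebra.algebraMap_eq_smul_one]

/-- Sweedler form of the power maps: `Ψ^{a+1}(x) = ∑ Ψ^a(x₁) x₂`. -/
theorem powerMap_succ (a : ℕ) :
    powerMap (H := H) (a + 1) =
      LinearMap.mul' ℝ H ∘ₗ TensorProduct.map (powerMap a) LinearMap.id ∘ₗ Coalgebra.comul := by
  have key : iterMul (H := H) (a + 1) ∘ₗ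
      ((TensorPower.mulEquiv (R := ℝ) (M := H) (n := a) (m := 1)).toLinearMap ∘ₗ
        TensorProduct.map (iterComul a)
          (toTensorOne (H := H)).toLinearMap) =
      LinearMap.mul' ℝ H ∘ₗ TensorProduct.map (powerMap a) LinearMap.id := by
    ext x y
    simpa [powerMap] using iterMul_mulEquiv a (iterComul a x) y
  rw [← LinearMap.comp_assoc, ← key]
  rfl

/-- The reduced coproduct `Δ̄(x) = Δ(x) - 1 ⊗ x - x ⊗ 1`. -/
def reducedComul (x : H) : H ⊗[ℝ] H :=
  Coalgebra.comul (R := ℝ) x - 1 ⊗ₜ[ℝ] x - x ⊗ₜ[ℝ] 1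

end Power

section Graded

variable {H : Type*} [Ring H] [HopfAlgebra ℝ H]

/-- The grading `𝒜` of the algebra `H` makes `H` a graded connected Hopf algebra with
finite-dimensional homogeneous components. -/
structure IsGradedConnected (𝒜 : ℕ → Submodule ℝ H) [GradedAlgebra 𝒜] : Prop where
  /-- `H₀ = ℝ · 1` -/
  connected : 𝒜 0 = 1
  finiteDimensional : ∀ n, FiniteDimensional ℝ (𝒜 n)
  /-- `Δ(Hₙ) ⊆ ⨁_{j + k = n} Hⱼ ⊗ Hₖ` -/
  comul_mem : ∀ n, ∀ x ∈ 𝒜 n, Coalgebra.comul (R := ℝ) x ∈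
    ⨆ p ∈ Finset.HasAntidiagonal.antidiagonal n,
      LinearMap.range (TensorProduct.map (𝒜 p.1).subtype (𝒜 p.2).subtype)
  counit_eq_zero : ∀ n, 0 < n → ∀ x ∈ 𝒜 n, Coalgebra.counit (R := ℝ) x = 0

end Graded

section Generators

variable {H : Type*} [Ring H] [HopfAlgebra ℝ H] {ι : Type*}

/-- `H` is, as an algebra, the polynomial algebra on the elements `gen i`. -/
def IsPolynomialOn (gen : ι → H) : Prop :=
  ∃ e : MvPolynomial ι ℝ ≃ₐ[ℝ] H, ∀ i, e (MvPolynomial.X i) = gen i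

/-- `H` is, as an algebra, the free associative algebra on the elements `gen i`. -/
def IsFreeAssociativeOn (gen : ι → H) : Prop :=
  ∃ e : FreeAlgebra ℝ ι ≃ₐ[ℝ] H, ∀ i, e (FreeAlgebra.ι ℝ i) = gen i

/-- `H` is, as an algebra, either polynomial on the `gen i`, or free associative on the `gen i`; in
the second case `H` is cocommutative. -/
def IsPolynomialOrCocommFree (gen : ι → H) : Prop :=
  IsPolynomialOn gen ∨ (IsFreeAssociativeOn gen ∧ Coalgebra.IsCocomm ℝ H)

/-- The set `ℬ` of all monomials (words) in the generators, including the empty monomial `1`;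
it is a submonoid of `H`. -/
def monomials (gen : ι → H) : Submonoid H := Submonoid.closure (Set.range gen)

/-- A generator, as an element of `ℬ`. -/
def genMonomial (gen : ι → H) (i : ι) : monomials gen :=
  ⟨gen i, Submonoid.subset_closure ⟨i, rfl⟩⟩

variable {gen : ι → H}

theorem linearIndependent_monomials (h : IsPolynomialOrCocommFree gen) :
    LinearIndependent ℝ (fun b : monomials gen => (b : H)) := by
  rcases h with ⟨e, he⟩ | ⟨⟨e, he⟩, -⟩
  · let v := (MvPolynomial.basisMonomials ι ℝ).map e.toLinearEquiv
    have hv : ∀ s, v s = e (MvPolynomial.monomial s 1) := fun s => by simp [v]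
    have hsub : (monomials gen : Set H) ⊆ Set.range v := by
      let S : Submonoid H :=
        { carrier := Set.range v
          one_mem' := ⟨0, by simp [hv]⟩
          mul_mem' := by
            rintro _ _ ⟨s, rfl⟩ ⟨t, rfl⟩
            exact ⟨s + t, by simp only [hv, ← map_mul, MvPolynomial.monomial_mul, mul_one]⟩ }
      have : monomials gen ≤ S := Submonoid.closure_le.2 (by
        rintro _ ⟨i, rfl⟩
        exact ⟨Finsupp.single i 1, by rw [hv, ← he]; rfl⟩)
      exact this
    exact v.linearIndependent.linearIndepOn_id.mono hsub
  · let v := (FreeAlgebra.basisFreeMonoid ℝ ι).map e.toLinearEquiv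
    have hv : ∀ s, v s = e (FreeAlgebra.equivMonoidAlgebraFreeMonoid.symm
        (MonoidAlgebra.of ℝ (FreeMonoid ι) s)) := fun s => rfl
    have hsub : (monomials gen : Set H) ⊆ Set.range v := by
      let S : Submonoid H :=
        { carrier := Set.range v
          one_mem' := ⟨1, by simp only [hv, map_one]⟩
          mul_mem' := by
            rintro _ _ ⟨s, rfl⟩ ⟨t, rfl⟩
            exact ⟨s * t, by simp only [hv, map_mul]⟩ }
      have : monomials gen ≤ S := Submonoid.closure_le.2 (by
        rintro _ ⟨i, rfl⟩
        refine ⟨FreeMonoid.of i, ?_⟩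
        rw [hv, ← he]
        congr 1
        rw [AlgEquiv.symm_apply_eq]
        simp [FreeAlgebra.equivMonoidAlgebraFreeMonoid])
      exact this
    exact v.linearIndependent.linearIndepOn_id.mono hsub

theorem span_monomials (h : IsPolynomialOrCocommFree gen) :
    ⊤ ≤ Submodule.span ℝ (Set.range fun b : monomials gen => (b : H)) := by
  have hr : Set.range (fun b : monomials gen => (b : H)) =
      (Submonoid.closure (Set.range gen) : Set H) := Subtype.range_coe
  rw [hr, ← Algebra.adjoin_eq_span, top_le_iff, Algebra.toSubmodule_eq_top]
  rcases h with ⟨e, he⟩ | ⟨⟨e, he⟩, -⟩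
  · have : Set.range gen = (e : MvPolynomial ι ℝ →ₐ[ℝ] H) '' Set.range MvPolynomial.X := by
      rw [← Set.range_comp]; congr 1; ext i; simp [he]
    rw [this, ← AlgHom.map_adjoin, MvPolynomial.adjoin_range_X, Algebra.map_top]
    exact (AlgHom.range_eq_top _).2 e.surjective
  · have : Set.range gen = (e : FreeAlgebra ℝ ι →ₐ[ℝ] H) '' Set.range (FreeAlgebra.ι ℝ) := by
      rw [← Set.range_comp]; congr 1; ext i; simp [he]
    rw [this, ← AlgHom.map_adjoin, FreeAlgebra.adjoin_range_ι, Algebra.map_top]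
    exact (AlgHom.range_eq_top _).2 e.surjective

/-- `ℬ`, as a basis of `H`. -/
def monomialBasis (h : IsPolynomialOrCocommFree gen) :
    Module.Basis (monomials gen) ℝ H :=
  Module.Basis.mk (linearIndependent_monomials h) (span_monomials h)

@[simp] theorem monomialBasis_apply (h : IsPolynomialOrCocommFree gen)
    (b : monomials gen) : monomialBasis h b = b := by
  simp [monomialBasis]

/-- The coefficients `K_a(b, b')` in `a^{-n} Ψ^a(v_b) = ∑_{b'} K_a(b, b') v_{b'}`, for a basis `v`
of `H` indexed by `ℬ`. -/
def powerCoeff (v : Module.Basis (monomials gen) ℝ H) (a n : ℕ) (b b' : monomials gen) : ℝ :=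
  v.repr (((a : ℝ) ^ n)⁻¹ • powerMap a (v b)) b'

variable {𝒜 : ℕ → Submodule ℝ H} [GradedAlgebra 𝒜]

theorem finite_monomials_degree (h𝒜 : IsGradedConnected 𝒜)
    (h : IsPolynomialOrCocommFree gen) (n : ℕ) :
    {b : monomials gen | (b : H) ∈ 𝒜 n}.Finite := by
  have := h𝒜.finiteDimensional n
  have hl : LinearIndependent ℝ
      (fun b : {b : monomials gen | (b : H) ∈ 𝒜 n} => (⟨(b.1 : H), b.2⟩ : 𝒜 n)) := by
    apply LinearIndependent.of_comp (𝒜 n).subtype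
    exact (linearIndependent_monomials h).comp _ Subtype.val_injective
  exact @Set.toFinite _ _ hl.finite

/-- The set `ℬₙ` of monomials of degree `n`. -/
def degreeMonomials (h𝒜 : IsGradedConnected 𝒜)
    (h : IsPolynomialOrCocommFree gen) (n : ℕ) : Finset (monomials gen) :=
  (finite_monomials_degree h𝒜 h n).toFinset

open Classical in
/-- The denominator `∑_{b ≠ c} φ(b) K₂(c, b)`, the sum over the monomials `b ≠ c` in `ℬₙ`, for a
generator `c = gen i` of degree `n`. -/
def rescalingDenom (h𝒜 : IsGradedConnected 𝒜)
    (h : IsPolynomialOrCocommFree gen) (φ : monomials gen → ℝ)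
    (i : ι) (n : ℕ) : ℝ :=
  ∑ b ∈ (degreeMonomials h𝒜 h n).erase (genMonomial gen i),
    φ b * powerCoeff (monomialBasis h) 2 n (genMonomial gen i) b

/-- The inductive rescaling `b ↦ b̂` of the monomials, together with the scale factors `φ`. -/
structure IsRescaling (h𝒜 : IsGradedConnected 𝒜)
    (h : IsPolynomialOrCocommFree gen) (deg : ι → ℕ)
    (hat : monomials gen → H) (φ : monomials gen → ℝ) : Prop where
  /-- `ĉ = c` for a generator `c` of degree one -/
  hat_gen_of_deg_eq_one : ∀ i, deg i = 1 → hat (genMonomial gen i) = gen i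
  /-- `ĉ = (1 - 2^{1 - deg c}) / (∑_{b ≠ c} φ(b) K₂(c, b)) • c` for a generator `c` of degree
  greater than one -/
  hat_gen_of_one_lt_deg : ∀ i, 1 < deg i → hat (genMonomial gen i) =
    ((1 - (2 : ℝ) ^ (1 - (deg i : ℤ))) / rescalingDenom h𝒜 h φ i (deg i)) • gen i
  /-- `b̂ = ĉ₁ ⋯ ĉₗ` whenever `b = c₁ ⋯ cₗ` with generators `c₁, …, cₗ` -/
  hat_prod : ∀ l : List ι, hat ((l.map (genMonomial gen)).prod) =
    (l.map fun i => hat (genMonomial gen i)).prod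
  /-- `b = φ(b) b̂` -/
  eq_smul_hat : ∀ b : monomials gen, (b : H) = φ b • hat b

end Generators

end HopfPower

end

/-!
The scaling function `φ` is the restriction to monomials of a character of `H`, that is, of an algebra
homomorphism `φ : H → ℝ`; such a homomorphism is given by arbitrary values on the generators. In these
terms the row sums of the rescaled matrix are `φ(b)⁻¹ a⁻ⁿ φ(Ψᵃ(b))`, so the claim is that
`φ ∘ Ψᵃ = aⁿ φ` on `Hₙ`.

*Existence, uniqueness and positivity.* For a generator `c` of degree `n`, no monomial in `m(Δ̄(c))`
is a generator, so the denominator in the definition of `ĉ` is `2⁻ⁿ (φ ⊗ φ)(Δ̄(c))`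
(`rescalingDenom_character`). It involves `φ` only in degrees below `n`, and it is positive, since
`Δ̄(c) ≠ 0` has non-negative coefficients (`rescalingDenom_pos`). So the values of `φ` on the generators
are given by a recursion on the degree (`scale`), and every rescaling arises from its solution
(`IsRescaling.eq_scaleCharacter`).

*Row sums.* The recursion says that `φ ∘ Ψ² = 2ⁿ φ` on generators. Since `φ ∘ Ψ² = φ * φ` (convolution)
is again a character, this holds on all of `Hₙ` (`character_powerMap_two`). The functional
`f = φ ∘ Ψᵃ` is the convolution power `φᵃ`, and therefore also satisfies `f * f = 2ⁿ f` on `Hₙ`. As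
`(f * f)(x) = 2 f(x) + (f ⊗ f)(Δ̄(x))`, a solution `f` of this equation with `f(1) = 1` is determined by
its values in degree one, where `f = a φ`; by induction `f = aⁿ φ` on `Hₙ` (`character_powerMap`).

*Non-negativity.* `Δ` is multiplicative, so `Δ(b)` has non-negative coefficients for every monomial `b`;
hence so does `Ψᵃ(b)`, by induction on `a` (`powerMap_nonneg`). Rescaling by positive numbers does not
change signs.
-/

open scoped TensorProduct

noncomputable section

namespace HopfPower

/-! ### Monomials and characters -/

section Words

variable {H : Type*} [Ring H] {ι : Type*} {gen : ι → H}

theorem exists_list_prod_eq (b : monomials gen) :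
    ∃ l : List ι, (l.map (genMonomial gen)).prod = b := by
  obtain ⟨b, hb⟩ := b
  induction hb using Submonoid.closure_induction with
  | mem x hx =>
    obtain ⟨i, rfl⟩ := hx
    exact ⟨[i], by simp [genMonomial]⟩
  | one => exact ⟨[], rfl⟩
  | mul x y hx hy ihx ihy =>
    obtain ⟨l, hl⟩ := ihx
    obtain ⟨m, hm⟩ := ihy
    exact ⟨l ++ m, by rw [List.map_append, List.prod_append, hl, hm]; rfl⟩

theorem coe_list_prod (l : List ι) :
    (((l.map (genMonomial gen)).prod : monomials gen) : H) = (l.map gen).prod := by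
  rw [Submonoid.coe_list_prod, List.map_map]; rfl

end Words

section Characters

variable {H : Type*} [Ring H] [HopfAlgebra ℝ H] {ι : Type*} {gen : ι → H}

theorem exists_character (h : IsPolynomialOrCocommFree gen) (w : ι → ℝ) :
    ∃ χ : H →ₐ[ℝ] ℝ, ∀ i, χ (gen i) = w i := by
  rcases h with ⟨e, he⟩ | ⟨⟨e, he⟩, -⟩
  · exact ⟨(MvPolynomial.aeval w).comp e.symm, fun i => by simp [← he]⟩
  · exact ⟨(FreeAlgebra.lift ℝ w).comp e.symm, fun i => by simp [← he]⟩

/-- The algebra homomorphism `H → ℝ` with prescribed values on the generators. -/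
def character (h : IsPolynomialOrCocommFree gen) (w : ι → ℝ) : H →ₐ[ℝ] ℝ :=
  (exists_character h w).choose

@[simp] theorem character_gen (h : IsPolynomialOrCocommFree gen) (w : ι → ℝ) (i : ι) :
    character h w (gen i) = w i :=
  (exists_character h w).choose_spec i

theorem character_list_prod (h : IsPolynomialOrCocommFree gen) (w : ι → ℝ) (l : List ι) :
    character h w ((l.map (genMonomial gen)).prod : monomials gen) = (l.map w).prod := by
  rw [coe_list_prod, map_list_prod, List.map_map]
  congr 2
  ext i
  simp

theorem character_pos (h : IsPolynomialOrCocommFree gen) {w : ι → ℝ} (hw : ∀ i, 0 < w i)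
    (b : monomials gen) : 0 < character h w b := by
  obtain ⟨l, rfl⟩ := exists_list_prod_eq b
  rw [character_list_prod]
  exact List.prod_pos (by simpa using fun i _ => hw i)

theorem monomial_ne_zero (h : IsPolynomialOrCocommFree gen) (b : monomials gen) : (b : H) ≠ 0 :=
  (linearIndependent_monomials h).ne_zero b

/-- A generator is not a proper product: the character with value `2` on all generators reads off
the length of a word. -/
theorem mul_ne_genMonomial (h : IsPolynomialOrCocommFree gen) {b b' : monomials gen}
    (hb : b ≠ 1) (hb' : b' ≠ 1) (i : ι) : b * b' ≠ genMonomial gen i := by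
  obtain ⟨l, rfl⟩ := exists_list_prod_eq b
  obtain ⟨m, rfl⟩ := exists_list_prod_eq b'
  intro heq
  have h1 : character h (fun _ => 2) ((((l ++ m).map (genMonomial gen)).prod : monomials gen) : H)
      = character h (fun _ => 2) (([i].map (genMonomial gen)).prod : monomials gen) := by
    rw [List.map_append, List.prod_append, heq]; simp
  rw [character_list_prod, character_list_prod] at h1
  simp only [List.map_const', List.prod_replicate, List.length_append, List.length_singleton] at h1
  have h2 : l.length + m.length = 1 := pow_right_injective₀ (by norm_num) (by norm_num) h1
  rcases l with _ | ⟨_, l⟩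
  · exact hb rfl
  rcases m with _ | ⟨_, m⟩
  · exact hb' rfl
  simp at h2
  omega

theorem monomialBasis_coe (h : IsPolynomialOrCocommFree gen) :
    (monomialBasis h : monomials gen → H) = fun b : monomials gen => (b : H) :=
  funext (monomialBasis_apply h)

theorem repr_coe (h : IsPolynomialOrCocommFree gen) (b : monomials gen) :
    (monomialBasis h).repr (b : H) = Finsupp.single b 1 := by
  rw [← monomialBasis_apply h b, Module.Basis.repr_self]

end Characters

/-! ### The grading -/

section Graded

variable {H : Type*} [Ring H] [HopfAlgebra ℝ H] {ι : Type*} {gen : ι → H}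
  {𝒜 : ℕ → Submodule ℝ H} [GradedAlgebra 𝒜] {deg : ι → ℕ}

theorem list_prod_mem (hdeg : ∀ i, gen i ∈ 𝒜 (deg i)) (l : List ι) :
    (((l.map (genMonomial gen)).prod : monomials gen) : H) ∈ 𝒜 (l.map deg).sum := by
  rw [coe_list_prod]
  exact SetLike.list_prod_map_mem_graded l deg gen fun i _ => hdeg i

theorem mem_degreeMonomials {h𝒜 : IsGradedConnected 𝒜} {h : IsPolynomialOrCocommFree gen} {n : ℕ}
    {b : monomials gen} : b ∈ degreeMonomials h𝒜 h n ↔ (b : H) ∈ 𝒜 n := by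
  simp [degreeMonomials]

theorem span_degreeMonomials (h𝒜 : IsGradedConnected 𝒜) (h : IsPolynomialOrCocommFree gen)
    (hdeg : ∀ i, gen i ∈ 𝒜 (deg i)) (n : ℕ) :
    Submodule.span ℝ ((fun b : monomials gen => (b : H)) '' (degreeMonomials h𝒜 h n)) = 𝒜 n := by
  apply le_antisymm
  · rw [Submodule.span_le]
    rintro _ ⟨b, hb, rfl⟩
    exact mem_degreeMonomials.1 hb
  · intro x hx
    rw [← DirectSum.decompose_of_mem_same 𝒜 hx, ← GradedAlgebra.proj_apply]
    clear hx
    have hx' : x ∈ Submodule.span ℝ (Set.range fun b : monomials gen => (b : H)) :=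
      span_monomials h trivial
    induction hx' using Submodule.span_induction with
    | mem y hy =>
      obtain ⟨b, rfl⟩ := hy
      obtain ⟨l, rfl⟩ := exists_list_prod_eq b
      have hl := list_prod_mem hdeg l
      rw [GradedAlgebra.proj_apply]
      by_cases hn : (l.map deg).sum = n
      · subst hn
        rw [DirectSum.decompose_of_mem_same 𝒜 hl]
        exact Submodule.subset_span ⟨_, mem_degreeMonomials.2 hl, rfl⟩
      · rw [DirectSum.decompose_of_mem_ne 𝒜 hl hn]
        exact zero_mem _
    | zero => rw [map_zero]; exact zero_mem _
    | add y z _ _ hy hz => rw [map_add]; exact add_mem hy hz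
    | smul r y _ hy => rw [map_smul]; exact Submodule.smul_mem _ r hy

theorem repr_eq_zero_of_notMem (h𝒜 : IsGradedConnected 𝒜) (h : IsPolynomialOrCocommFree gen)
    (hdeg : ∀ i, gen i ∈ 𝒜 (deg i)) {n : ℕ} {x : H} (hx : x ∈ 𝒜 n) {b : monomials gen}
    (hb : b ∉ degreeMonomials h𝒜 h n) : (monomialBasis h).repr x b = 0 := by
  rw [← span_degreeMonomials h𝒜 h hdeg, ← monomialBasis_coe h, Module.Basis.mem_span_image] at hx
  by_contra hne
  exact hb (hx (Finsupp.mem_support_iff.2 hne))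

theorem one_notMem_degreeMonomials (h𝒜 : IsGradedConnected 𝒜) (h : IsPolynomialOrCocommFree gen)
    {n : ℕ} (hn : 0 < n) : (1 : monomials gen) ∉ degreeMonomials h𝒜 h n := fun h1 =>
  hn.ne (DirectSum.degree_eq_of_mem_mem 𝒜 SetLike.GradedOne.one_mem (mem_degreeMonomials.1 h1)
    (monomial_ne_zero h 1))

/-- A linear identity on `Hₙ` may be checked on monomials. -/
theorem eq_of_eq_on_degreeMonomials {M : Type*} [AddCommGroup M] [Module ℝ M]
    (h𝒜 : IsGradedConnected 𝒜) (h : IsPolynomialOrCocommFree gen)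
    (hdeg : ∀ i, gen i ∈ 𝒜 (deg i)) {n : ℕ} {f g : H →ₗ[ℝ] M}
    (hfg : ∀ b ∈ degreeMonomials h𝒜 h n, f b = g b) {x : H} (hx : x ∈ 𝒜 n) : f x = g x := by
  rw [← span_degreeMonomials h𝒜 h hdeg] at hx
  refine LinearMap.eqOn_span (f := f) (g := g) ?_ hx
  rintro _ ⟨b, hb, rfl⟩
  exact hfg b hb

/-- A generator has positive degree: otherwise it would be a scalar, on which all characters agree. -/
theorem deg_pos (h𝒜 : IsGradedConnected 𝒜) (h : IsPolynomialOrCocommFree gen)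
    (hdeg : ∀ i, gen i ∈ 𝒜 (deg i)) (i : ι) : 0 < deg i := by
  rw [Nat.pos_iff_ne_zero]
  intro h0
  have hi := hdeg i
  rw [h0, h𝒜.connected, Submodule.mem_one] at hi
  obtain ⟨r, hr⟩ := hi
  have h1 := character_gen h (fun _ => 0) i
  have h2 := character_gen h (fun _ => 1) i
  rw [← hr, AlgHom.commutes] at h1 h2
  exact zero_ne_one (h1.symm.trans h2)

/-- To see that `Δ(x)` lies in a subspace, for `x ∈ Hₙ`, it suffices to look at the pure tensors of
total degree `n`. -/
theorem comul_mem_of_tmul_mem (h𝒜 : IsGradedConnected 𝒜) {n : ℕ} {S : Submodule ℝ (H ⊗[ℝ] H)}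
    (hS : ∀ i j, i + j = n → ∀ y ∈ 𝒜 i, ∀ z ∈ 𝒜 j, y ⊗ₜ[ℝ] z ∈ S) {x : H} (hx : x ∈ 𝒜 n) :
    Coalgebra.comul (R := ℝ) x ∈ S := by
  refine (iSup₂_le fun p hp => ?_ :
    (⨆ p ∈ Finset.HasAntidiagonal.antidiagonal n,
      LinearMap.range (TensorProduct.map (𝒜 p.1).subtype (𝒜 p.2).subtype)) ≤ S)
      (h𝒜.comul_mem n x hx)
  rintro _ ⟨t, rfl⟩
  induction t with
  | zero => rw [map_zero]; exact zero_mem _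
  | tmul y z => exact hS _ _ (Finset.HasAntidiagonal.mem_antidiagonal.1 hp) _ y.2 _ z.2
  | add t u ht hu => rw [map_add]; exact add_mem ht hu

/-- The projection `x ↦ x - ε(x) 1` onto the augmentation ideal. -/
def augmentationProj : H →ₗ[ℝ] H :=
  LinearMap.id - Algebra.linearMap ℝ H ∘ₗ Coalgebra.counit

theorem augmentationProj_of_pos (h𝒜 : IsGradedConnected 𝒜) {n : ℕ} (hn : 0 < n) {x : H}
    (hx : x ∈ 𝒜 n) : augmentationProj x = x := by
  simp [augmentationProj, h𝒜.counit_eq_zero n hn x hx]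

theorem augmentationProj_of_zero (h𝒜 : IsGradedConnected 𝒜) {x : H}
    (hx : x ∈ 𝒜 0) : augmentationProj x = 0 := by
  rw [h𝒜.connected, Submodule.mem_one] at hx
  obtain ⟨r, rfl⟩ := hx
  simp [augmentationProj]

theorem map_augmentationProj_comul (x : H) :
    TensorProduct.map augmentationProj augmentationProj (Coalgebra.comul (R := ℝ) x) =
      reducedComul x + Coalgebra.counit (R := ℝ) x • (1 ⊗ₜ[ℝ] 1) := by
  have key : ∀ t : H ⊗[ℝ] H, TensorProduct.map augmentationProj augmentationProj t =
      t - TensorProduct.map (Algebra.linearMap ℝ H) LinearMap.id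
            (LinearMap.rTensor H (Coalgebra.counit (R := ℝ)) t)
        - TensorProduct.map LinearMap.id (Algebra.linearMap ℝ H)
            (LinearMap.lTensor H (Coalgebra.counit (R := ℝ)) t)
        + TensorProduct.map (Algebra.linearMap ℝ H) (Algebra.linearMap ℝ H ∘ₗ Coalgebra.counit)
            (LinearMap.rTensor H (Coalgebra.counit (R := ℝ)) t) := by
    intro t
    induction t with
    | zero => simp
    | tmul y z =>
      simp [augmentationProj, TensorProduct.sub_tmul, TensorProduct.tmul_sub]
      abel
    | add t u ht hu => simp only [map_add, ht, hu]; abel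
  rw [key, Coalgebra.rTensor_counit_comul, Coalgebra.lTensor_counit_comul]
  simp [reducedComul, Algebra.algebraMap_eq_smul_one]

/-- For `x` of positive degree, `Δ̄(x)` lies in the span of the tensors of positive bidegree. -/
theorem reducedComul_mem_of_tmul_mem (h𝒜 : IsGradedConnected 𝒜) {n : ℕ} (hn : 0 < n)
    {S : Submodule ℝ (H ⊗[ℝ] H)}
    (hS : ∀ i j, i + j = n → 0 < i → 0 < j → ∀ y ∈ 𝒜 i, ∀ z ∈ 𝒜 j, y ⊗ₜ[ℝ] z ∈ S)
    {x : H} (hx : x ∈ 𝒜 n) : reducedComul x ∈ S := by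
  have h1 := map_augmentationProj_comul x
  rw [h𝒜.counit_eq_zero n hn x hx, zero_smul, add_zero] at h1
  rw [← h1]
  refine comul_mem_of_tmul_mem (S := S.comap
    (TensorProduct.map augmentationProj augmentationProj)) h𝒜 (fun i j hij y hy z hz => ?_) hx
  rw [Submodule.mem_comap, TensorProduct.map_tmul]
  rcases Nat.eq_zero_or_pos i with rfl | hi
  · rw [augmentationProj_of_zero h𝒜 hy, TensorProduct.zero_tmul]; exact zero_mem _
  rcases Nat.eq_zero_or_pos j with rfl | hj
  · rw [augmentationProj_of_zero h𝒜 hz, TensorProduct.tmul_zero]; exact zero_mem _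
  rw [augmentationProj_of_pos h𝒜 hi hy, augmentationProj_of_pos h𝒜 hj hz]
  exact hS i j hij hi hj y hy z hz

theorem comul_eq_reducedComul_add (x : H) :
    Coalgebra.comul (R := ℝ) x = reducedComul x + 1 ⊗ₜ[ℝ] x + x ⊗ₜ[ℝ] 1 := by
  rw [reducedComul]; abel

theorem reducedComul_of_degree_one (h𝒜 : IsGradedConnected 𝒜) {x : H} (hx : x ∈ 𝒜 1) :
    reducedComul x = 0 := by
  have := reducedComul_mem_of_tmul_mem (S := ⊥) h𝒜 one_pos
    (fun i j hij hi hj => by omega) hx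
  simpa using this

theorem powerMap_mem (h𝒜 : IsGradedConnected 𝒜) (a : ℕ) {n : ℕ} {x : H} (hx : x ∈ 𝒜 n) :
    powerMap a x ∈ 𝒜 n := by
  induction a generalizing n x with
  | zero =>
    rw [powerMap_zero, LinearMap.comp_apply]
    rcases Nat.eq_zero_or_pos n with rfl | hn
    · rw [h𝒜.connected, Submodule.mem_one]
      exact ⟨_, rfl⟩
    · rw [h𝒜.counit_eq_zero n hn x hx, map_zero]; exact zero_mem _
  | succ a ih =>
    rw [powerMap_succ]
    refine comul_mem_of_tmul_mem (S := (𝒜 n).comap (LinearMap.mul' ℝ H ∘ₗ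
      TensorProduct.map (powerMap a) LinearMap.id)) h𝒜 (fun i j hij y hy z hz => ?_) hx
    subst hij
    simpa using SetLike.mul_mem_graded (ih hy) hz

end Graded

/-! ### Characters composed with Hopf powers -/

section Convolution

open WithConv

variable {H : Type*} [Ring H] [HopfAlgebra ℝ H] {ι : Type*} {gen : ι → H}
  {𝒜 : ℕ → Submodule ℝ H} [GradedAlgebra 𝒜] {deg : ι → ℕ}

theorem character_powerMap_eq_convPow (χ : H →ₐ[ℝ] ℝ) (a : ℕ) (x : H) :
    χ (powerMap a x) = (toConv χ.toLinearMap ^ a).ofConv x := by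
  induction a generalizing x with
  | zero => simp [powerMap_zero, LinearMap.convOne_def]
  | succ a ih =>
    rw [powerMap_succ, pow_succ, LinearMap.convMul_def]
    simp only [LinearMap.comp_apply]
    generalize Coalgebra.comul (R := ℝ) x = t
    induction t with
    | zero => simp
    | tmul y z => simp [ih]
    | add t u ht hu => simp only [map_add, ht, hu]

/-- Precomposing functionals with `x ↦ rⁿ x` (on `Hₙ`) is compatible with convolution powers, because
`Δ` respects the grading. -/
theorem convPow_eq_of_eq (h𝒜 : IsGradedConnected 𝒜) {r : ℝ} {f g : WithConv (H →ₗ[ℝ] ℝ)}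
    (hfg : ∀ n, ∀ x ∈ 𝒜 n, f.ofConv x = r ^ n * g.ofConv x) (a : ℕ) {n : ℕ} {x : H}
    (hx : x ∈ 𝒜 n) : (f ^ a).ofConv x = r ^ n * (g ^ a).ofConv x := by
  induction a generalizing n x with
  | zero =>
    simp only [pow_zero, LinearMap.convOne_def, ofConv_toConv, LinearMap.comp_apply]
    rcases Nat.eq_zero_or_pos n with rfl | hn
    · simp
    · simp [h𝒜.counit_eq_zero n hn x hx]
  | succ a ih =>
    rw [pow_succ, pow_succ, LinearMap.convMul_def, LinearMap.convMul_def]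
    refine comul_mem_of_tmul_mem (S := LinearMap.eqLocus
      (LinearMap.mul' ℝ ℝ ∘ₗ TensorProduct.map (f ^ a).ofConv f.ofConv)
      (r ^ n • (LinearMap.mul' ℝ ℝ ∘ₗ TensorProduct.map (g ^ a).ofConv g.ofConv)))
      h𝒜 (fun i j hij y hy z hz => ?_) hx
    subst hij
    simp only [LinearMap.mem_eqLocus, LinearMap.comp_apply, TensorProduct.map_tmul,
      LinearMap.mul'_apply, LinearMap.smul_apply, smul_eq_mul, ih hy, hfg j z hz]
    ring

theorem powerMap_apply_one (a : ℕ) : powerMap a (1 : H) = 1 := by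
  induction a with
  | zero => simp [powerMap_zero]
  | succ a ih => simp [powerMap_succ, Algebra.TensorProduct.one_def, ih]

theorem powerMap_of_degree_one (h𝒜 : IsGradedConnected 𝒜) (a : ℕ) {x : H} (hx : x ∈ 𝒜 1) :
    powerMap a x = (a : ℝ) • x := by
  induction a with
  | zero => simp [powerMap_zero, h𝒜.counit_eq_zero 1 one_pos x hx]
  | succ a ih =>
    rw [powerMap_succ, LinearMap.comp_apply, LinearMap.comp_apply, comul_eq_reducedComul_add,
      reducedComul_of_degree_one h𝒜 hx]
    simp [ih, powerMap_apply_one, add_smul, add_comm]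

theorem powerMap_one_apply (x : H) : powerMap 1 x = x := by
  rw [powerMap_succ, powerMap_zero, LinearMap.comp_apply]
  have : ∀ t : H ⊗[ℝ] H, LinearMap.mul' ℝ H (TensorProduct.map
      (Algebra.linearMap ℝ H ∘ₗ Coalgebra.counit) LinearMap.id t) =
      TensorProduct.lid ℝ H (LinearMap.rTensor H (Coalgebra.counit (R := ℝ)) t) := by
    intro t
    induction t with
    | zero => simp
    | tmul y z => simp [Algebra.smul_def]
    | add t u ht hu => simp only [map_add, ht, hu]
  rw [LinearMap.comp_apply, this, Coalgebra.rTensor_counit_comul]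
  simp

theorem powerMap_two (x : H) :
    powerMap 2 x = LinearMap.mul' ℝ H (Coalgebra.comul (R := ℝ) x) := by
  have : powerMap (H := H) 1 = LinearMap.id := LinearMap.ext powerMap_one_apply
  rw [powerMap_succ, this, TensorProduct.map_id]
  rfl

theorem convMul_self_apply (f : WithConv (H →ₗ[ℝ] ℝ)) (hf : f.ofConv 1 = 1) (x : H) :
    (f * f).ofConv x =
      2 * f.ofConv x + LinearMap.mul' ℝ ℝ
        (TensorProduct.map f.ofConv f.ofConv (reducedComul x)) := by
  rw [LinearMap.convMul_def, ofConv_toConv, LinearMap.comp_apply, LinearMap.comp_apply,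
    comul_eq_reducedComul_add]
  simp only [map_add, TensorProduct.map_tmul, LinearMap.mul'_apply, hf]
  ring

/-- If `χ ∘ Ψ² = 2ⁿ χ` on every `Hₙ`, then `χ ∘ Ψᵃ = aⁿ χ` on every `Hₙ`, for all `a`.
The functional `f = χ ∘ Ψᵃ` is the convolution power `χᵃ`, so it inherits `f * f = 2ⁿ f`; for `n ≥ 2`
this expresses `(2ⁿ - 2) f` on `Hₙ` through the values of `f` in lower degrees. -/
theorem character_powerMap (h𝒜 : IsGradedConnected 𝒜) (χ : H →ₐ[ℝ] ℝ)
    (hχ : ∀ n, ∀ x ∈ 𝒜 n, χ (powerMap 2 x) = 2 ^ n * χ x) (a : ℕ) {n : ℕ} {x : H}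
    (hx : x ∈ 𝒜 n) : χ (powerMap a x) = (a : ℝ) ^ n * χ x := by
  induction n using Nat.strong_induction_on generalizing x with
  | _ n ih =>
  obtain rfl | rfl | hn : n = 0 ∨ n = 1 ∨ 2 ≤ n := by omega
  · rw [h𝒜.connected, Submodule.mem_one] at hx
    obtain ⟨r, rfl⟩ := hx
    simp [Algebra.algebraMap_eq_smul_one, powerMap_apply_one]
  · simp [powerMap_of_degree_one h𝒜 a hx]
  set g : WithConv (H →ₗ[ℝ] ℝ) := toConv χ.toLinearMap with hg
  set f : WithConv (H →ₗ[ℝ] ℝ) := g ^ a with hf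
  have hfx : ∀ y, χ (powerMap a y) = f.ofConv y := character_powerMap_eq_convPow χ a
  have hgx : ∀ y, χ y = g.ofConv y := fun y => rfl
  have hgg : ∀ n, ∀ x ∈ 𝒜 n, (g * g).ofConv x = 2 ^ n * g.ofConv x := fun n x hx => by
    rw [← pow_two, ← character_powerMap_eq_convPow]; exact hχ n x hx
  have hff : (f * f).ofConv x = 2 ^ n * f.ofConv x := by
    rw [hf, ← (Commute.refl g).mul_pow a]
    exact convPow_eq_of_eq h𝒜 hgg a hx
  have hgg' := hgg n x hx
  rw [convMul_self_apply _ (by rw [← hfx, powerMap_apply_one, map_one])] at hff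
  rw [convMul_self_apply _ (by rw [← hgx, map_one])] at hgg'
  have hred : LinearMap.mul' ℝ ℝ (TensorProduct.map f.ofConv f.ofConv (reducedComul x)) =
      (a : ℝ) ^ n * LinearMap.mul' ℝ ℝ (TensorProduct.map g.ofConv g.ofConv (reducedComul x)) := by
    refine reducedComul_mem_of_tmul_mem (S := LinearMap.eqLocus
      (LinearMap.mul' ℝ ℝ ∘ₗ TensorProduct.map f.ofConv f.ofConv)
      ((a : ℝ) ^ n • (LinearMap.mul' ℝ ℝ ∘ₗ TensorProduct.map g.ofConv g.ofConv)))
      h𝒜 (by omega) (fun i j hij hi hj y hy z hz => ?_) hx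
    subst hij
    simp only [LinearMap.mem_eqLocus, LinearMap.comp_apply, TensorProduct.map_tmul,
      LinearMap.mul'_apply, LinearMap.smul_apply, smul_eq_mul, ← hfx, ← hgx,
      ih i (by omega) hy, ih j (by omega) hz]
    ring
  have h2 : (2 : ℝ) ^ n - 2 ≠ 0 := by
    have : (2 : ℝ) ^ 2 ≤ 2 ^ n := pow_le_pow_right₀ (by norm_num) hn
    intro h0; linarith
  rw [hfx, hgx]
  apply mul_left_cancel₀ h2
  linear_combination (a : ℝ) ^ n * hgg' - hff + hred

/-- `χ ∘ Ψ² = χ * χ` is again an algebra homomorphism, because `ℝ` is commutative; so it is determined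
by its values on the generators. -/
theorem character_powerMap_two (h𝒜 : IsGradedConnected 𝒜) (h : IsPolynomialOrCocommFree gen)
    (hdeg : ∀ i, gen i ∈ 𝒜 (deg i)) (χ : H →ₐ[ℝ] ℝ)
    (hχ : ∀ i, χ (powerMap 2 (gen i)) = 2 ^ deg i * χ (gen i)) {n : ℕ} {x : H} (hx : x ∈ 𝒜 n) :
    χ (powerMap 2 x) = 2 ^ n * χ x := by
  have hmul : ∀ y, χ (powerMap 2 y) = (toConv χ ^ 2).ofConv y := fun y => by
    rw [character_powerMap_eq_convPow, ← AlgHom.toLinearMap_convPow]; rfl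
  refine eq_of_eq_on_degreeMonomials (f := χ.toLinearMap ∘ₗ powerMap 2)
    (g := (2 : ℝ) ^ n • χ.toLinearMap) h𝒜 h hdeg (fun b hb => ?_) hx
  obtain ⟨l, rfl⟩ := exists_list_prod_eq b
  obtain rfl : n = (l.map deg).sum := DirectSum.degree_eq_of_mem_mem 𝒜
    (mem_degreeMonomials.1 hb) (list_prod_mem hdeg l) (monomial_ne_zero h _)
  simp only [LinearMap.comp_apply, LinearMap.smul_apply, AlgHom.toLinearMap_apply, smul_eq_mul]
  rw [hmul, coe_list_prod]
  clear hb hx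
  induction l with
  | nil => simp
  | cons i l ih =>
    rw [List.map_cons, List.prod_cons, map_mul, map_mul, ih, ← hmul, hχ, List.map_cons,
      List.sum_cons, pow_add]
    ring

end Convolution

/-! ### Non-negativity of coefficients -/

theorem repr_map_nonneg {κ κ' M N : Type*} [AddCommGroup M] [Module ℝ M] [AddCommGroup N]
    [Module ℝ N] (v : Module.Basis κ ℝ M) (u : Module.Basis κ' ℝ N) (L : M →ₗ[ℝ] N)
    (hL : ∀ k k', 0 ≤ u.repr (L (v k)) k') {x : M} (hx : ∀ k, 0 ≤ v.repr x k) (k' : κ') :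
    0 ≤ u.repr (L x) k' := by
  rw [← v.linearCombination_repr x, Finsupp.linearCombination_apply, Finsupp.sum, map_sum, map_sum,
    Finset.sum_apply']
  refine Finset.sum_nonneg fun k _ => ?_
  rw [map_smul, map_smul, Finsupp.smul_apply, smul_eq_mul]
  exact mul_nonneg (hx k) (hL k k')

section Nonneg

variable {H : Type*} [Ring H] [HopfAlgebra ℝ H] {ι : Type*} {gen : ι → H}
  {𝒜 : ℕ → Submodule ℝ H} [GradedAlgebra 𝒜] {deg : ι → ℕ}

theorem repr_mul_nonneg {κ A : Type*} [Ring A] [Algebra ℝ A] (v : Module.Basis κ ℝ A)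
    (hv : ∀ j k l, 0 ≤ v.repr (v j * v k) l) {x y : A} (hx : ∀ k, 0 ≤ v.repr x k)
    (hy : ∀ k, 0 ≤ v.repr y k) (k : κ) : 0 ≤ v.repr (x * y) k :=
  repr_map_nonneg v v (LinearMap.mulLeft ℝ x)
    (fun j => repr_map_nonneg v v (LinearMap.mulRight ℝ (v j)) (fun i => hv i j) hx) hy k

theorem single_one_nonneg {κ : Type*} (j k : κ) : 0 ≤ (Finsupp.single j (1 : ℝ)) k := by
  classical
  rw [Finsupp.single_apply]
  split_ifs <;> norm_num

theorem monomialBasis_mul_nonneg (h : IsPolynomialOrCocommFree gen) (b b' c : monomials gen) :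
    0 ≤ (monomialBasis h).repr (monomialBasis h b * monomialBasis h b') c := by
  rw [monomialBasis_apply, monomialBasis_apply, ← Submonoid.coe_mul, repr_coe]
  exact single_one_nonneg _ _

theorem tensorBasis_apply (h : IsPolynomialOrCocommFree gen) (p : monomials gen × monomials gen) :
    (monomialBasis h).tensorProduct (monomialBasis h) p = (p.1 : H) ⊗ₜ[ℝ] (p.2 : H) := by
  rw [Module.Basis.tensorProduct_apply', monomialBasis_apply, monomialBasis_apply]

theorem tensorBasis_repr_coe (h : IsPolynomialOrCocommFree gen) (b b' : monomials gen) :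
    ((monomialBasis h).tensorProduct (monomialBasis h)).repr ((b : H) ⊗ₜ[ℝ] (b' : H)) =
      Finsupp.single (b, b') 1 := by
  rw [← tensorBasis_apply h (b, b'), Module.Basis.repr_self]

theorem tensorBasis_mul_nonneg (h : IsPolynomialOrCocommFree gen)
    (p q s : monomials gen × monomials gen) :
    0 ≤ ((monomialBasis h).tensorProduct (monomialBasis h)).repr
      ((monomialBasis h).tensorProduct (monomialBasis h) p *
        (monomialBasis h).tensorProduct (monomialBasis h) q) s := by
  rw [tensorBasis_apply, tensorBasis_apply, Algebra.TensorProduct.tmul_mul_tmul,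
    ← Submonoid.coe_mul, ← Submonoid.coe_mul, tensorBasis_repr_coe]
  exact single_one_nonneg _ _

/-- Non-negativity of the coproduct passes from the generators to all monomials, because `Δ` is
multiplicative; generators of degree one are primitive. -/
theorem comul_nonneg (h𝒜 : IsGradedConnected 𝒜) (h : IsPolynomialOrCocommFree gen)
    (hdeg : ∀ i, gen i ∈ 𝒜 (deg i))
    (hnonneg : ∀ i, 1 < deg i → ∀ p : monomials gen × monomials gen,
      0 ≤ ((monomialBasis h).tensorProduct (monomialBasis h)).repr
        (Coalgebra.comul (R := ℝ) (gen i)) p)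
    (b : monomials gen) (p : monomials gen × monomials gen) :
    0 ≤ ((monomialBasis h).tensorProduct (monomialBasis h)).repr
      (Coalgebra.comul (R := ℝ) (b : H)) p := by
  obtain ⟨l, rfl⟩ := exists_list_prod_eq b
  rw [coe_list_prod]
  induction l generalizing p with
  | nil =>
    have := tensorBasis_repr_coe h 1 1
    rw [Submonoid.coe_one] at this
    rw [List.map_nil, List.prod_nil, Bialgebra.comul_one, Algebra.TensorProduct.one_def, this]
    exact single_one_nonneg _ _
  | cons i l ih =>
    rw [List.map_cons, List.prod_cons, Bialgebra.comul_mul]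
    refine repr_mul_nonneg _ (tensorBasis_mul_nonneg h) (fun q => ?_) ih p
    obtain hi | hi : deg i = 1 ∨ 1 < deg i := by have := deg_pos h𝒜 h hdeg i; omega
    · rw [comul_eq_reducedComul_add, reducedComul_of_degree_one h𝒜 (hi ▸ hdeg i), zero_add]
      have h1 := tensorBasis_repr_coe h 1 (genMonomial gen i)
      have h2 := tensorBasis_repr_coe h (genMonomial gen i) 1
      rw [Submonoid.coe_one] at h1 h2
      change _ = Finsupp.single _ _ at h1
      rw [map_add, Finsupp.add_apply]
      refine add_nonneg ?_ ?_
      · exact h1 ▸ single_one_nonneg _ _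
      · exact h2 ▸ single_one_nonneg _ _
    · exact hnonneg i hi q

theorem powerMap_nonneg (h𝒜 : IsGradedConnected 𝒜) (h : IsPolynomialOrCocommFree gen)
    (hdeg : ∀ i, gen i ∈ 𝒜 (deg i))
    (hnonneg : ∀ i, 1 < deg i → ∀ p : monomials gen × monomials gen,
      0 ≤ ((monomialBasis h).tensorProduct (monomialBasis h)).repr
        (Coalgebra.comul (R := ℝ) (gen i)) p)
    (a : ℕ) (b c : monomials gen) :
    0 ≤ (monomialBasis h).repr (powerMap a (b : H)) c := by
  have hone : (monomialBasis h).repr 1 = Finsupp.single 1 1 := repr_coe h 1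
  induction a generalizing b c with
  | zero =>
    rw [powerMap_zero, LinearMap.comp_apply, Algebra.linearMap_apply,
      Algebra.algebraMap_eq_smul_one, map_smul, Finsupp.smul_apply, hone, smul_eq_mul]
    refine mul_nonneg ?_ (single_one_nonneg _ _)
    obtain ⟨l, rfl⟩ := exists_list_prod_eq b
    rcases Nat.eq_zero_or_pos (l.map deg).sum with h0 | h0
    · rcases l with _ | ⟨i, l⟩
      · simp
      · have := deg_pos h𝒜 h hdeg i
        simp at h0
        omega
    · rw [h𝒜.counit_eq_zero _ h0 _ (list_prod_mem hdeg l)]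
  | succ a ih =>
    rw [powerMap_succ, ← LinearMap.comp_assoc, LinearMap.comp_apply]
    refine repr_map_nonneg ((monomialBasis h).tensorProduct (monomialBasis h)) _ _
      (fun p => ?_) (comul_nonneg h𝒜 h hdeg hnonneg b) c
    rw [tensorBasis_apply, LinearMap.comp_apply, TensorProduct.map_tmul, LinearMap.mul'_apply]
    refine repr_mul_nonneg _ (monomialBasis_mul_nonneg h) (ih p.1) fun k => ?_
    rw [LinearMap.id_apply, repr_coe]
    exact single_one_nonneg _ _

/-- The reduced coproduct has the coefficients of `Δ`, except that those involving `1` vanish. -/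
theorem reducedComul_nonneg (h𝒜 : IsGradedConnected 𝒜) (h : IsPolynomialOrCocommFree gen)
    (hdeg : ∀ i, gen i ∈ 𝒜 (deg i)) {n : ℕ} (hn : 0 < n) {x : H} (hx : x ∈ 𝒜 n)
    (hnonneg : ∀ p : monomials gen × monomials gen,
      0 ≤ ((monomialBasis h).tensorProduct (monomialBasis h)).repr (Coalgebra.comul (R := ℝ) x) p)
    (p : monomials gen × monomials gen) :
    0 ≤ ((monomialBasis h).tensorProduct (monomialBasis h)).repr (reducedComul x) p := by
  have hone : (monomialBasis h).repr 1 = Finsupp.single 1 1 := repr_coe h 1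
  obtain ⟨b, b'⟩ := p
  by_cases hp : b = 1 ∨ b' = 1
  · refine le_of_eq (Eq.symm ?_)
    refine reducedComul_mem_of_tmul_mem (S := LinearMap.ker
      (((monomialBasis h).tensorProduct (monomialBasis h)).coord (b, b')))
      h𝒜 hn (fun i j hij hi hj y hy z hz => ?_) hx
    rw [LinearMap.mem_ker, Module.Basis.coord_apply, Module.Basis.tensorProduct_repr_tmul_apply]
    rcases hp with rfl | rfl
    · rw [repr_eq_zero_of_notMem h𝒜 h hdeg hy (one_notMem_degreeMonomials h𝒜 h hi), smul_zero]
    · rw [repr_eq_zero_of_notMem h𝒜 h hdeg hz (one_notMem_degreeMonomials h𝒜 h hj), zero_smul]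
  · push Not at hp
    have h1 := hnonneg (b, b')
    rw [comul_eq_reducedComul_add] at h1
    simpa [Module.Basis.tensorProduct_repr_tmul_apply, hone, Finsupp.single_apply, hp.1.symm,
      hp.2.symm] using h1

end Nonneg

/-! ### The scale factors -/

section Scale

variable {H : Type*} [Ring H] [HopfAlgebra ℝ H] {ι : Type*} {gen : ι → H}
  {𝒜 : ℕ → Submodule ℝ H} [GradedAlgebra 𝒜] {deg : ι → ℕ}

theorem sum_repr_smul (h𝒜 : IsGradedConnected 𝒜) (h : IsPolynomialOrCocommFree gen)
    (hdeg : ∀ i, gen i ∈ 𝒜 (deg i)) {n : ℕ} {x : H} (hx : x ∈ 𝒜 n) :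
    ∑ b ∈ degreeMonomials h𝒜 h n, (monomialBasis h).repr x b • (b : H) = x := by
  conv_rhs => rw [← (monomialBasis h).linearCombination_repr x]
  rw [Finsupp.linearCombination_apply, Finsupp.sum_of_support_subset (s := degreeMonomials h𝒜 h n)]
  · simp
  · intro b hb
    by_contra hb'
    exact Finsupp.mem_support_iff.1 hb (repr_eq_zero_of_notMem h𝒜 h hdeg hx hb')
  · simp

theorem powerMap_two_eq (x : H) :
    powerMap 2 x = (2 : ℝ) • x + LinearMap.mul' ℝ H (reducedComul x) := by
  rw [powerMap_two, comul_eq_reducedComul_add]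
  simp [two_smul]
  abel

theorem mul_map_character (χ : H →ₐ[ℝ] ℝ) (t : H ⊗[ℝ] H) :
    LinearMap.mul' ℝ ℝ (TensorProduct.map χ.toLinearMap χ.toLinearMap t) =
      χ (LinearMap.mul' ℝ H t) :=
  (LinearMap.congr_fun (AlgHom.comp_mul' χ) t).symm

theorem repr_mul_reducedComul_genMonomial (h𝒜 : IsGradedConnected 𝒜)
    (h : IsPolynomialOrCocommFree gen) (hdeg : ∀ i, gen i ∈ 𝒜 (deg i)) {n : ℕ} (hn : 0 < n)
    {x : H} (hx : x ∈ 𝒜 n) (i : ι) :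
    (monomialBasis h).repr (LinearMap.mul' ℝ H (reducedComul x)) (genMonomial gen i) = 0 := by
  refine reducedComul_mem_of_tmul_mem (S := LinearMap.ker
    ((monomialBasis h).coord (genMonomial gen i) ∘ₗ LinearMap.mul' ℝ H))
    h𝒜 hn (fun j k hjk hj hk y hy z hz => ?_) hx
  rw [LinearMap.mem_ker, LinearMap.comp_apply, LinearMap.mul'_apply]
  refine eq_of_eq_on_degreeMonomials (g := 0) (f := (monomialBasis h).coord (genMonomial gen i) ∘ₗ
    LinearMap.mulRight ℝ z) h𝒜 h hdeg (fun b hb => ?_) hy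
  refine eq_of_eq_on_degreeMonomials (g := 0) (f := (monomialBasis h).coord (genMonomial gen i) ∘ₗ
    LinearMap.mulLeft ℝ (b : H)) h𝒜 h hdeg (fun b' hb' => ?_) hz
  have hb1 : b ≠ 1 := fun h1 => one_notMem_degreeMonomials h𝒜 h hj (h1 ▸ hb)
  have hb1' : b' ≠ 1 := fun h1 => one_notMem_degreeMonomials h𝒜 h hk (h1 ▸ hb')
  rw [LinearMap.comp_apply, LinearMap.mulLeft_apply, Module.Basis.coord_apply, ← Submonoid.coe_mul,
    repr_coe, Finsupp.single_eq_of_ne (mul_ne_genMonomial h hb1 hb1' i).symm,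
    LinearMap.zero_apply]

/-- For a character `χ`, the denominator attached to a generator `c` of degree `n` is
`2⁻ⁿ (χ ⊗ χ)(Δ̄(c))`: the monomials other than `c` in `Ψ²(c) = 2 c + m(Δ̄(c))` are exactly those of
`m(Δ̄(c))`. -/
theorem rescalingDenom_character (h𝒜 : IsGradedConnected 𝒜) (h : IsPolynomialOrCocommFree gen)
    (hdeg : ∀ i, gen i ∈ 𝒜 (deg i)) (χ : H →ₐ[ℝ] ℝ) (i : ι) :
    rescalingDenom h𝒜 h (fun b => χ b) i (deg i) =
      ((2 : ℝ) ^ deg i)⁻¹ * LinearMap.mul' ℝ ℝ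
        (TensorProduct.map χ.toLinearMap χ.toLinearMap (reducedComul (gen i))) := by
  classical
  have hn := deg_pos h𝒜 h hdeg i
  have hmem : genMonomial gen i ∈ degreeMonomials h𝒜 h (deg i) :=
    mem_degreeMonomials.2 (hdeg i)
  have hsum := congrArg χ (sum_repr_smul h𝒜 h hdeg (powerMap_mem h𝒜 2 (hdeg i)))
  rw [map_sum, ← Finset.add_sum_erase _ _ hmem] at hsum
  have hc : (monomialBasis h).repr (powerMap 2 (gen i)) (genMonomial gen i) = 2 := by
    have : (monomialBasis h).repr (gen i) = Finsupp.single (genMonomial gen i) 1 :=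
      repr_coe h (genMonomial gen i)
    rw [powerMap_two_eq, map_add, map_smul, Finsupp.add_apply,
      repr_mul_reducedComul_genMonomial h𝒜 h hdeg hn (hdeg i), this]
    simp
  have hχ : χ (powerMap 2 (gen i)) = (2 : ℝ) • χ (gen i) + LinearMap.mul' ℝ ℝ
      (TensorProduct.map χ.toLinearMap χ.toLinearMap (reducedComul (gen i))) := by
    rw [powerMap_two_eq, map_add, map_smul, mul_map_character]
  have hcoe : ((genMonomial gen i : monomials gen) : H) = gen i := rfl
  rw [hc, hχ, map_smul, hcoe, add_right_inj] at hsum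
  rw [← hsum, rescalingDenom, Finset.mul_sum]
  refine Finset.sum_congr rfl fun b _ => ?_
  rw [powerCoeff, monomialBasis_apply, hcoe]
  simp only [map_smul, Finsupp.smul_apply, smul_eq_mul, Nat.cast_ofNat]
  ring

theorem rescalingDenom_pos (h𝒜 : IsGradedConnected 𝒜) (h : IsPolynomialOrCocommFree gen)
    (hdeg : ∀ i, gen i ∈ 𝒜 (deg i)) {i : ι}
    (hnonneg : ∀ p : monomials gen × monomials gen,
      0 ≤ ((monomialBasis h).tensorProduct (monomialBasis h)).repr
        (Coalgebra.comul (R := ℝ) (gen i)) p)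
    (hreduced : reducedComul (gen i) ≠ 0) {χ : H →ₐ[ℝ] ℝ} (hχ : ∀ b : monomials gen, 0 < χ b) :
    0 < rescalingDenom h𝒜 h (fun b => χ b) i (deg i) := by
  rw [rescalingDenom_character h𝒜 h hdeg]
  refine mul_pos (by positivity) ?_
  have hnn := reducedComul_nonneg h𝒜 h hdeg (deg_pos h𝒜 h hdeg i) (hdeg i) hnonneg
  set u := (monomialBasis h).tensorProduct (monomialBasis h)
  rw [← u.linearCombination_repr (reducedComul (gen i)), Finsupp.linearCombination_apply,
    Finsupp.sum, map_sum, map_sum]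
  refine Finset.sum_pos (fun p hp => ?_) ?_
  · rw [tensorBasis_apply]
    simp only [map_smul, TensorProduct.map_tmul, LinearMap.mul'_apply, smul_eq_mul]
    exact mul_pos ((hnn p).lt_of_ne (Finsupp.mem_support_iff.1 hp).symm)
      (mul_pos (hχ p.1) (hχ p.2))
  · rw [Finsupp.support_nonempty_iff]
    simpa using hreduced

theorem one_sub_two_zpow_pos {n : ℕ} (hn : 1 < n) : 0 < 1 - (2 : ℝ) ^ (1 - (n : ℤ)) := by
  have : (2 : ℝ) ^ (1 - (n : ℤ)) < 1 := zpow_lt_one_of_neg₀ (by norm_num) (by omega)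
  linarith

/-- The right-hand side of the recursion for the scale factor of the generator `gen i`, in terms of
the scale factors `w` of all generators (only those of lower degree matter). -/
def scaleStep (h𝒜 : IsGradedConnected 𝒜) (h : IsPolynomialOrCocommFree gen) (deg : ι → ℕ)
    (w : ι → ℝ) (i : ι) : ℝ :=
  if 1 < deg i then
    rescalingDenom h𝒜 h (fun b => character h w b) i (deg i) / (1 - (2 : ℝ) ^ (1 - (deg i : ℤ)))
  else 1

theorem scaleStep_pos (h𝒜 : IsGradedConnected 𝒜) (h : IsPolynomialOrCocommFree gen)
    (hdeg : ∀ i, gen i ∈ 𝒜 (deg i))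
    (hnonneg : ∀ i, 1 < deg i → ∀ p : monomials gen × monomials gen,
      0 ≤ ((monomialBasis h).tensorProduct (monomialBasis h)).repr
        (Coalgebra.comul (R := ℝ) (gen i)) p)
    (hreduced : ∀ i, 1 < deg i → reducedComul (gen i) ≠ 0)
    {w : ι → ℝ} (hw : ∀ i, 0 < w i) (i : ι) : 0 < scaleStep h𝒜 h deg w i := by
  rw [scaleStep]
  split_ifs with hi
  · exact div_pos (rescalingDenom_pos h𝒜 h hdeg (hnonneg i hi) (hreduced i hi)
      (character_pos h hw)) (one_sub_two_zpow_pos hi)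
  · exact one_pos

theorem character_congr (h𝒜 : IsGradedConnected 𝒜) (h : IsPolynomialOrCocommFree gen)
    (hdeg : ∀ i, gen i ∈ 𝒜 (deg i)) {n : ℕ} {w w' : ι → ℝ} (hw : ∀ j, deg j ≤ n → w j = w' j)
    {x : H} (hx : x ∈ 𝒜 n) : character h w x = character h w' x := by
  refine eq_of_eq_on_degreeMonomials (f := (character h w).toLinearMap)
    (g := (character h w').toLinearMap) h𝒜 h hdeg (fun b hb => ?_) hx
  obtain ⟨l, rfl⟩ := exists_list_prod_eq b
  obtain rfl : n = (l.map deg).sum := DirectSum.degree_eq_of_mem_mem 𝒜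
    (mem_degreeMonomials.1 hb) (list_prod_mem hdeg l) (monomial_ne_zero h _)
  rw [AlgHom.toLinearMap_apply, AlgHom.toLinearMap_apply, character_list_prod, character_list_prod]
  congr 1
  exact List.map_congr_left fun j hj => hw j (List.le_sum_of_mem (List.mem_map_of_mem hj))

theorem scaleStep_congr (h𝒜 : IsGradedConnected 𝒜) (h : IsPolynomialOrCocommFree gen)
    (hdeg : ∀ i, gen i ∈ 𝒜 (deg i)) {w w' : ι → ℝ} {i : ι}
    (hw : ∀ j, deg j < deg i → w j = w' j) :
    scaleStep h𝒜 h deg w i = scaleStep h𝒜 h deg w' i := by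
  rw [scaleStep, scaleStep, rescalingDenom_character h𝒜 h hdeg, rescalingDenom_character h𝒜 h hdeg]
  congr 3
  refine reducedComul_mem_of_tmul_mem (S := LinearMap.eqLocus
    (LinearMap.mul' ℝ ℝ ∘ₗ TensorProduct.map (character h w).toLinearMap
      (character h w).toLinearMap)
    (LinearMap.mul' ℝ ℝ ∘ₗ TensorProduct.map (character h w').toLinearMap
      (character h w').toLinearMap))
    h𝒜 (deg_pos h𝒜 h hdeg i) (fun j k hjk hj hk y hy z hz => ?_) (hdeg i)
  simp only [LinearMap.mem_eqLocus, LinearMap.comp_apply, TensorProduct.map_tmul,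
    LinearMap.mul'_apply, AlgHom.toLinearMap_apply]
  rw [character_congr h𝒜 h hdeg (fun l hl => hw l (by omega)) hy,
    character_congr h𝒜 h hdeg (fun l hl => hw l (by omega)) hz]

/-- The solution of the recursion. In the recursive call, the generators whose degree is not smaller
than that of `gen i` get the dummy value `1`, which keeps all values positive. -/
def scale (h𝒜 : IsGradedConnected 𝒜) (h : IsPolynomialOrCocommFree gen) (deg : ι → ℕ) (i : ι) : ℝ :=
  scaleStep h𝒜 h deg (fun j => if _ : deg j < deg i then scale h𝒜 h deg j else 1) i
termination_by deg i

theorem scale_eq_scaleStep (h𝒜 : IsGradedConnected 𝒜) (h : IsPolynomialOrCocommFree gen)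
    (hdeg : ∀ i, gen i ∈ 𝒜 (deg i)) (i : ι) :
    scale h𝒜 h deg i = scaleStep h𝒜 h deg (scale h𝒜 h deg) i := by
  conv_lhs => rw [scale]
  exact scaleStep_congr h𝒜 h hdeg fun j hj => dif_pos hj

theorem scale_pos (h𝒜 : IsGradedConnected 𝒜) (h : IsPolynomialOrCocommFree gen)
    (hdeg : ∀ i, gen i ∈ 𝒜 (deg i))
    (hnonneg : ∀ i, 1 < deg i → ∀ p : monomials gen × monomials gen,
      0 ≤ ((monomialBasis h).tensorProduct (monomialBasis h)).repr
        (Coalgebra.comul (R := ℝ) (gen i)) p)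
    (hreduced : ∀ i, 1 < deg i → reducedComul (gen i) ≠ 0) (i : ι) : 0 < scale h𝒜 h deg i := by
  induction hn : deg i using Nat.strong_induction_on generalizing i with
  | _ n ih =>
  subst hn
  rw [scale]
  refine scaleStep_pos h𝒜 h hdeg hnonneg hreduced (fun j => ?_) i
  split_ifs with hj
  · exact ih _ hj j rfl
  · exact one_pos

/-- The recursion has only one solution. -/
theorem eq_scale (h𝒜 : IsGradedConnected 𝒜) (h : IsPolynomialOrCocommFree gen)
    (hdeg : ∀ i, gen i ∈ 𝒜 (deg i)) {w : ι → ℝ} (hw : ∀ i, w i = scaleStep h𝒜 h deg w i) :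
    w = scale h𝒜 h deg := by
  ext i
  induction hn : deg i using Nat.strong_induction_on generalizing i with
  | _ n ih =>
  subst hn
  rw [hw, scale_eq_scaleStep h𝒜 h hdeg]
  exact scaleStep_congr h𝒜 h hdeg fun j hj => ih _ hj j rfl

/-- The character of `H` that takes the values `scale` on the generators; its restriction to the
monomials is the scaling function `φ`. -/
def scaleCharacter (h𝒜 : IsGradedConnected 𝒜) (h : IsPolynomialOrCocommFree gen) (deg : ι → ℕ) :
    H →ₐ[ℝ] ℝ :=
  character h (scale h𝒜 h deg)

theorem isRescaling_scaleCharacter (h𝒜 : IsGradedConnected 𝒜) (h : IsPolynomialOrCocommFree gen)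
    (hdeg : ∀ i, gen i ∈ 𝒜 (deg i)) (hpos : ∀ i, 0 < scale h𝒜 h deg i) :
    IsRescaling h𝒜 h deg (fun b : monomials gen => (scaleCharacter h𝒜 h deg b)⁻¹ • (b : H))
      (fun b : monomials gen => scaleCharacter h𝒜 h deg b) := by
  have hgen : ∀ i, scaleCharacter h𝒜 h deg (genMonomial gen i : monomials gen) =
      scaleStep h𝒜 h deg (scale h𝒜 h deg) i := fun i =>
    (character_gen h _ i).trans (scale_eq_scaleStep h𝒜 h hdeg i)
  refine ⟨fun i hi => ?_, fun i hi => ?_, fun l => ?_, fun b => ?_⟩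
  · simp only [hgen, scaleStep, hi, lt_irrefl, if_false, inv_one, one_smul]
    rfl
  · simp only [hgen, scaleStep, hi, if_true, inv_div]
    rfl
  · induction l with
    | nil => simp
    | cons i l ih =>
      simp only [List.map_cons, List.prod_cons, ← ih, Submonoid.coe_mul, map_mul, mul_inv,
        smul_mul_smul_comm]
  · exact (smul_inv_smul₀ (character_pos h hpos b).ne' _).symm

/-- Uniqueness of the rescaling: the rules force `φ` to be multiplicative on words and to satisfy the
recursion on generators. -/
theorem IsRescaling.eq_scaleCharacter {h𝒜 : IsGradedConnected 𝒜}
    {h : IsPolynomialOrCocommFree gen} (hdeg : ∀ i, gen i ∈ 𝒜 (deg i))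
    {hat : monomials gen → H} {φ : monomials gen → ℝ} (hr : IsRescaling h𝒜 h deg hat φ) :
    (hat = fun b : monomials gen => (scaleCharacter h𝒜 h deg b)⁻¹ • (b : H)) ∧
      φ = fun b : monomials gen => scaleCharacter h𝒜 h deg b := by
  have hφ : ∀ b, φ b ≠ 0 := fun b h0 =>
    monomial_ne_zero h b (by rw [hr.eq_smul_hat b, h0, zero_smul])
  have hhat : ∀ b, hat b = (φ b)⁻¹ • (b : H) := fun b => by
    conv_rhs => rw [hr.eq_smul_hat b]
    rw [inv_smul_smul₀ (hφ b)]
  have hinj : ∀ b, Function.Injective fun r : ℝ => r • (b : monomials gen).1 := fun b =>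
    smul_left_injective ℝ (monomial_ne_zero h b)
  -- `φ` is multiplicative, hence the restriction of a character
  have hchar : ∀ b : monomials gen, φ b = character h (fun i => φ (genMonomial gen i)) b := by
    intro b
    obtain ⟨l, rfl⟩ := exists_list_prod_eq b
    have h1 := hr.hat_prod l
    rw [hhat] at h1
    have h2 : ∀ l : List ι, (l.map fun i => hat (genMonomial gen i)).prod =
        ((l.map fun i => φ (genMonomial gen i)).prod)⁻¹ •
          (((l.map (genMonomial gen)).prod : monomials gen) : H) := by
      intro l
      induction l with
      | nil => simp
      | cons i l ih =>
        simp only [List.map_cons, List.prod_cons, ih, hhat (genMonomial gen i), Submonoid.coe_mul,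
          mul_inv, smul_mul_smul_comm]
    rw [h2] at h1
    rw [character_list_prod]
    exact inv_injective (hinj _ h1)
  have hw : (fun i => φ (genMonomial gen i)) = scale h𝒜 h deg := by
    refine eq_scale h𝒜 h hdeg fun i => ?_
    rw [scaleStep]
    split_ifs with hi
    · have h1 := hr.hat_gen_of_one_lt_deg i hi
      rw [hhat] at h1
      have h2 := hinj (genMonomial gen i) h1
      rw [← inv_div, ← inv_inj, inv_inv, ← funext hchar]
      exact h2
    · have hi1 : deg i = 1 := by have := deg_pos h𝒜 h hdeg i; omega
      have h1 := hr.hat_gen_of_deg_eq_one i hi1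
      rw [hhat] at h1
      exact inv_eq_one.1 (hinj (genMonomial gen i) (h1.trans (one_smul ℝ (gen i)).symm))
  have hfin : φ = fun b : monomials gen => scaleCharacter h𝒜 h deg b := by
    funext b
    rw [hchar, hw]; rfl
  exact ⟨funext fun b => by rw [hhat, hfin], hfin⟩

/-- `φ ∘ Ψᵃ = aⁿ φ` on `Hₙ`; on generators and for `a = 2` this is the recursion defining `φ`. -/
theorem scaleCharacter_powerMap (h𝒜 : IsGradedConnected 𝒜) (h : IsPolynomialOrCocommFree gen)
    (hdeg : ∀ i, gen i ∈ 𝒜 (deg i)) (a : ℕ) {n : ℕ} {x : H} (hx : x ∈ 𝒜 n) :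
    scaleCharacter h𝒜 h deg (powerMap a x) = (a : ℝ) ^ n * scaleCharacter h𝒜 h deg x := by
  refine character_powerMap h𝒜 _ (fun n x hx =>
    character_powerMap_two h𝒜 h hdeg _ (fun i => ?_) hx) a hx
  set χ := scaleCharacter h𝒜 h deg with hχ
  obtain hi | hi : deg i = 1 ∨ 1 < deg i := by have := deg_pos h𝒜 h hdeg i; omega
  · rw [powerMap_of_degree_one h𝒜 2 (hi ▸ hdeg i), hi]
    simp
  · have hstep : χ (gen i) = rescalingDenom h𝒜 h (fun b => χ b) i (deg i) /
        (1 - (2 : ℝ) ^ (1 - (deg i : ℤ))) := by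
      rw [hχ, scaleCharacter, character_gen, scale_eq_scaleStep h𝒜 h hdeg, scaleStep, if_pos hi]
    have hden := rescalingDenom_character h𝒜 h hdeg χ i
    rw [eq_div_iff (one_sub_two_zpow_pos hi).ne', hden, mul_map_character] at hstep
    have hz : (2 : ℝ) ^ (1 - (deg i : ℤ)) = 2 * (2 ^ deg i)⁻¹ := by
      rw [zpow_sub₀ two_ne_zero, zpow_one, zpow_natCast, div_eq_mul_inv]
    rw [hz] at hstep
    rw [powerMap_two_eq, map_add, map_smul, smul_eq_mul]
    have h2 : (2 : ℝ) ^ deg i ≠ 0 := by positivity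
    field_simp at hstep
    linear_combination -hstep

end Scale

end HopfPower

end

/-! ### The rescaled basis -/

open scoped TensorProduct in
open HopfPower in
theorem theorem3p1 {H : Type*} [Ring H] [HopfAlgebra ℝ H]
    (𝒜 : ℕ → Submodule ℝ H) [GradedAlgebra 𝒜] (h𝒜 : IsGradedConnected 𝒜)
    {ι : Type*} (gen : ι → H) (deg : ι → ℕ) (hdeg : ∀ i, gen i ∈ 𝒜 (deg i))
    (hgen : IsPolynomialOrCocommFree gen)
    -- generators of degree greater than one: coefficients of the coproduct, reduced coproduct
    (hnonneg : ∀ i, 1 < deg i → ∀ p : monomials gen × monomials gen,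
      0 ≤ ((monomialBasis hgen).tensorProduct (monomialBasis hgen)).repr
        (Coalgebra.comul (R := ℝ) (gen i)) p)
    (hreduced : ∀ i, 1 < deg i → reducedComul (gen i) ≠ 0) :
    -- the inductive rescaling is well defined
    (∃! r : (monomials gen → H) × (monomials gen → ℝ), IsRescaling h𝒜 hgen deg r.1 r.2) ∧
    ∀ (hat : monomials gen → H) (φ : monomials gen → ℝ), IsRescaling h𝒜 hgen deg hat φ →
      (∀ i, 1 < deg i → 0 < rescalingDenom h𝒜 hgen φ i (deg i)) ∧
      (∀ b, 0 < φ b) ∧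
      -- the rescaled monomials are a basis of `H`, those of degree `n` a basis of `𝒜 n`
      ∃ v : Module.Basis (monomials gen) ℝ H, (∀ b, v b = hat b) ∧
        ∀ n, Submodule.span ℝ (hat '' (degreeMonomials h𝒜 hgen n : Set (monomials gen))) = 𝒜 n ∧
          -- `a^{-n}` makes sense for `a ≥ 1`, and for `a = n = 0`
          ∀ a : ℕ, 1 ≤ a ∨ n = 0 → ∀ b ∈ degreeMonomials h𝒜 hgen n,
            ((a : ℝ) ^ n)⁻¹ • powerMap a (hat b) =
              ∑ b' ∈ degreeMonomials h𝒜 hgen n, powerCoeff v a n b b' • hat b' ∧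
            (∀ b' ∈ degreeMonomials h𝒜 hgen n,
              powerCoeff v a n b b' =
                (φ b)⁻¹ * powerCoeff (monomialBasis hgen) a n b b' * φ b' ∧
              0 ≤ powerCoeff v a n b b') ∧
            ∑ b' ∈ degreeMonomials h𝒜 hgen n, powerCoeff v a n b b' = 1 := by
  have hpos := scale_pos h𝒜 hgen hdeg hnonneg hreduced
  refine ⟨⟨(_, _), isRescaling_scaleCharacter h𝒜 hgen hdeg hpos, fun r hr =>
    Prod.ext (hr.eq_scaleCharacter hdeg).1 (hr.eq_scaleCharacter hdeg).2⟩, fun hat φ hr => ?_⟩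
  obtain ⟨rfl, rfl⟩ := hr.eq_scaleCharacter hdeg
  set χ := scaleCharacter h𝒜 hgen deg with hχdef
  have hχ : ∀ b : monomials gen, 0 < χ b := character_pos hgen hpos
  have hu : ∀ b : monomials gen, IsUnit (χ b)⁻¹ := fun b => (inv_pos.2 (hχ b)).ne'.isUnit
  have hv : ∀ b, (monomialBasis hgen).isUnitSMul hu b = (χ b)⁻¹ • (b : H) := fun b => by
    rw [Module.Basis.isUnitSMul_apply, monomialBasis_apply]
  have hcoeff : ∀ (a n : ℕ) (b b' : monomials gen),
      powerCoeff ((monomialBasis hgen).isUnitSMul hu) a n b b' =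
        (χ b)⁻¹ * powerCoeff (monomialBasis hgen) a n b b' * χ b' := fun a n b b' => by
    have hu' : ((hu b').unit⁻¹ : ℝˣ) = χ b' := by simp
    rw [powerCoeff, powerCoeff, Module.Basis.repr_isUnitSMul, hv, monomialBasis_apply,
      Units.smul_def, hu']
    simp only [map_smul, Finsupp.smul_apply, smul_eq_mul]
    ring
  refine ⟨fun i hi => rescalingDenom_pos h𝒜 hgen hdeg (hnonneg i hi) (hreduced i hi) hχ, hχ,
    (monomialBasis hgen).isUnitSMul hu, hv, fun n => ⟨?_, fun a ha b hb => ?_⟩⟩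
  · rw [← span_degreeMonomials h𝒜 hgen hdeg n]
    apply le_antisymm <;> rw [Submodule.span_le] <;> rintro _ ⟨b, hb, rfl⟩
    · exact Submodule.smul_mem _ _ (Submodule.subset_span ⟨b, hb, rfl⟩)
    · beta_reduce
      rw [← smul_inv_smul₀ (hχ b).ne' (b : H)]
      exact Submodule.smul_mem _ _ (Submodule.subset_span ⟨b, hb, rfl⟩)
  have han : (a : ℝ) ^ n ≠ 0 := by
    rcases ha with ha | rfl
    · exact pow_ne_zero _ (by exact_mod_cast (Nat.one_le_iff_ne_zero.1 ha))
    · simp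
  have hexp := sum_repr_smul h𝒜 hgen hdeg
    (powerMap_mem h𝒜 a (mem_degreeMonomials.1 hb))
  have hK : ∀ b', powerCoeff (monomialBasis hgen) a n b b' =
      ((a : ℝ) ^ n)⁻¹ * (monomialBasis hgen).repr (powerMap a (b : H)) b' := fun b' => by
    rw [powerCoeff, monomialBasis_apply, map_smul, Finsupp.smul_apply, smul_eq_mul]
  refine ⟨?_, fun b' _ => ⟨hcoeff a n b b', ?_⟩, ?_⟩
  · conv_lhs => rw [map_smul, ← hexp, Finset.smul_sum, Finset.smul_sum]
    refine Finset.sum_congr rfl fun b' _ => ?_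
    rw [hcoeff, hK, smul_smul, smul_smul, smul_smul]
    congr 1
    field_simp [(hχ b').ne']
  · rw [hcoeff, hK]
    have := powerMap_nonneg h𝒜 hgen hdeg hnonneg a b b'
    have h1 := hχ b
    have h2 := hχ b'
    positivity
  · -- the row sum is `φ(b)⁻¹ a⁻ⁿ φ(Ψᵃ(b))`
    have h1 := scaleCharacter_powerMap h𝒜 hgen hdeg a (mem_degreeMonomials.1 hb)
    rw [← hχdef] at h1
    have h2 := congrArg χ hexp
    rw [map_sum, h1] at h2
    simp only [map_smul, smul_eq_mul] at h2
    simp only [hcoeff, hK, mul_assoc, ← Finset.mul_sum, h2]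
    rw [inv_mul_cancel_left₀ han, inv_mul_cancel₀ (hχ b).ne']
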